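/- Let $\Omega$ be a compact metric space and let $\varphi:\Omega\to\Omega$ be continuous (not necessarily injective or surjective); the pair $(\Omega,\varphi)$ is called a semicascade. Let $X=C(\Omega)$ be the Banach space of continuous scalar functions on $\Omega$ (real or complex), let $U\in\mathcal L(X)$, $Ux=x\circ\varphi$, and let $V=U^{*}\in\mathcal L(X^{*})$. A net $(V_\alpha)$ in $\mathcal L(X^*)$ is called ergodic if each $V_\alpha$ belongs to the convex hull $\operatorname{co}\{V^n:n\ge 0\}$ and $\bigl(x,(\mathrm{Id}-V)V_\alpha\mu\bigr)\to 0$ for all $x\in X$, $\mu\in X^*$. It converges if there is $Q\in\mathcal L(X^*)$ with $(x,V_\alpha\mu)\to(x,Q\mu)$ for all $x\in X$, $\mu\in X^*$. An ergodic sequence is an ergodic net indexed by $\mathbb N$. For $\omega\in\Omega$ let $\overline{o}(\omega)$ be the closure of $\{\varphi^n\omega:n\ge 0\}$. A minimal set is a set that is minimal under inclusion among the nonempty closed sets $m\subseteq\Omega$ with $\varphi(m)\subseteq m$. For a closed set $S$ with $\varphi(S)\subseteq S$, the subsystem $(S,\varphi)$ is uniquely ergodic if it has exactly one $\varphi$-invariant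 Borel probability measure. Consider the following properties. - (AEN) All ergodic nets converge. - (AES) All ergodic sequences converge. - (SES) Some ergodic sequence converges. - $\mathrm{UE}(\overline{o})$: for every $\omega\in\Omega$ the subsystem $(\overline{o}(\omega),\varphi)$ is uniquely ergodic. - (single $m$ in $\overline{o}$): for every $\omega\in\Omega$ the set $\overline{o}(\omega)$ contains exactly one minimal set. - ($\operatorname{supp}\mu_e=m$): the support of every $\varphi$-ergodic Borel probability measure on $\Omega$ is a minimal set. - (single $\mu_e$ on $m$): for every minimal set $m$ the subsystem $(m,\varphi)$ is uniquely ergodic. **Lemma 3.2.** For every semicascade $(\Omega,\varphi)$: (i) (AEN) $\Rightarrow$ $\mathrm{UE}(\overline{o})$, and $\mathrm{UE}(\overline{o})$ $\Rightarrow$ (AES). (ii) (SES) $\Rightarrow$ (single $\mu_e$ on $m$). (iii) $\mathrm{UE}(\overline{o})$ holds if and only if (single $m$ in $\overline{o}$), ($\operatorname{supp}\mu_e=m$) and (single $\mu_e$ on $m$) all hold. -/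

import Mathlib

open Filter Topology MeasureTheory Set

universe u v w

namespace Semicascade

noncomputable section

/-! ### Ergodic nets of operators

Here `X* = StrongDual 𝕜 X` with `𝕜 = ℝ` or `𝕜 = ℂ`. -/

section Operators

variable {𝕜 : Type v} [RCLike 𝕜] {X : Type u} [NormedAddCommGroup X] [NormedSpace 𝕜 X]

/-- The Banach-space adjoint `V = U*` on `X*`, `(V μ) x = μ (U x)`. -/
def adjointOp (U : X →L[𝕜] X) : StrongDual 𝕜 X →L[𝕜] StrongDual 𝕜 X :=
  ContinuousLinearMap.precomp 𝕜 U

/-- The convex hull `co {V ^ n : n ∈ ℕ₀}` in `𝓛(E)`: all finite convex combinations, with real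
weights `c n ≥ 0` of sum `1`, of the powers of `V`. -/
def coPowers {E : Type u} [NormedAddCommGroup E] [NormedSpace 𝕜 E] (V : E →L[𝕜] E) :
    Set (E →L[𝕜] E) :=
  {T | ∃ (s : Finset ℕ) (c : ℕ → ℝ), (∀ n ∈ s, 0 ≤ c n) ∧ ∑ n ∈ s, c n = 1 ∧
    T = ∑ n ∈ s, (c n : 𝕜) • V ^ n}

/-- `coPowers V` is the convex hull in the usual sense. -/
theorem coPowers_eq_convexHull {E : Type u} [NormedAddCommGroup E] [NormedSpace 𝕜 E]
    [NormedSpace ℝ E] [IsScalarTower ℝ 𝕜 E] (V : E →L[𝕜] E) :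
    coPowers V = convexHull ℝ (range fun n : ℕ => V ^ n) := by
  have key : ∀ (a : ℝ) (T : E →L[𝕜] E), (a : 𝕜) • T = a • T := fun a T => by
    ext x; simp
  apply subset_antisymm
  · rintro _ ⟨s, c, h0, h1, rfl⟩
    simp_rw [key]
    exact (convex_convexHull ℝ _).sum_mem h0 h1 fun n _ => subset_convexHull _ _ ⟨n, rfl⟩
  · intro T hT
    rw [convexHull_range_eq_exists_affineCombination] at hT
    obtain ⟨s, w, h0, h1, rfl⟩ := hT
    refine ⟨s, w, h0, h1, ?_⟩
    rw [Finset.affineCombination_eq_linear_combination _ _ _ h1]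
    simp_rw [key]

/-- A net `(W_α)` in `𝓛(X*)` is ergodic (for the operator `V = U*`) if each `W_α` lies in
`co {V ^ n : n ∈ ℕ₀}` and `(Id - V) W_α → 0` in the weak-star operator topology. -/
structure IsErgodicNet (U : X →L[𝕜] X) {A : Type w} [Preorder A]
    (W : A → StrongDual 𝕜 X →L[𝕜] StrongDual 𝕜 X) : Prop where
  mem_coPowers : ∀ α, W α ∈ coPowers (adjointOp U)
  tendsto_zero : ∀ (x : X) (μ : StrongDual 𝕜 X),
    Tendsto (fun α => (((1 - adjointOp U) * W α) μ) x) atTop (𝓝 0)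

/-- Convergence of a net in `𝓛(X*)` in the weak-star operator topology. -/
def ConvergesWStarO {A : Type w} [Preorder A]
    (W : A → StrongDual 𝕜 X →L[𝕜] StrongDual 𝕜 X) : Prop :=
  ∃ Q : StrongDual 𝕜 X →L[𝕜] StrongDual 𝕜 X,
    ∀ (x : X) (μ : StrongDual 𝕜 X), Tendsto (fun α => (W α μ) x) atTop (𝓝 ((Q μ) x))

end Operators

/-! ### Convergence properties of a semicascade -/

section Convergence

variable (𝕜 : Type v) [RCLike 𝕜] {Ω : Type u} [TopologicalSpace Ω] [CompactSpace Ω]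

/-- The Koopman operator `U x = x ∘ φ` on the Banach space `X = C(Ω)`. -/
def koopman (φ : C(Ω, Ω)) : C(Ω, 𝕜) →L[𝕜] C(Ω, 𝕜) :=
  ContinuousMap.compCLM 𝕜 𝕜 φ

/-- (AEN): all ergodic nets converge. A net is indexed by a nonempty directed preordered type,
here of an arbitrary universe `w`. -/
def AllErgodicNetsConverge (φ : C(Ω, Ω)) : Prop :=
  ∀ (A : Type w) [Preorder A] [IsDirectedOrder A] [Nonempty A]
    (W : A → StrongDual 𝕜 C(Ω, 𝕜) →L[𝕜] StrongDual 𝕜 C(Ω, 𝕜)),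
    IsErgodicNet (koopman 𝕜 φ) W → ConvergesWStarO W

/-- (AES): all ergodic sequences converge. -/
def AllErgodicSequencesConverge (φ : C(Ω, Ω)) : Prop :=
  ∀ W : ℕ → StrongDual 𝕜 C(Ω, 𝕜) →L[𝕜] StrongDual 𝕜 C(Ω, 𝕜),
    IsErgodicNet (koopman 𝕜 φ) W → ConvergesWStarO W

/-- (SES): some ergodic sequence converges. -/
def SomeErgodicSequenceConverges (φ : C(Ω, Ω)) : Prop :=
  ∃ W : ℕ → StrongDual 𝕜 C(Ω, 𝕜) →L[𝕜] StrongDual 𝕜 C(Ω, 𝕜),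
    IsErgodicNet (koopman 𝕜 φ) W ∧ ConvergesWStarO W

end Convergence

/-! ### Dynamical notions -/

section Dynamics

/-- There is exactly one invariant probability measure. -/
def UniquelyErgodic {Y : Type u} [MeasurableSpace Y] (T : Y → Y) : Prop :=
  ∃! μ : Measure Y, IsProbabilityMeasure μ ∧ MeasurePreserving T μ μ

variable {Ω : Type u} [TopologicalSpace Ω]

/-- The closure of the forward orbit `{φ^n ω : n ≥ 0}`. -/
def orbitClosure (φ : C(Ω, Ω)) (ω : Ω) : Set Ω :=
  closure (range fun n : ℕ => φ^[n] ω)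

/-- A minimal set: minimal with respect to inclusion among the nonempty closed sets `s` with
`φ(s) ⊆ s`. -/
def IsMinimalSet (φ : C(Ω, Ω)) (m : Set Ω) : Prop :=
  Minimal (fun s : Set Ω => s.Nonempty ∧ IsClosed s ∧ MapsTo φ s s) m

theorem mapsTo_orbitClosure (φ : C(Ω, Ω)) (ω : Ω) :
    MapsTo φ (orbitClosure φ ω) (orbitClosure φ ω) := by
  refine MapsTo.closure ?_ φ.continuous
  rintro _ ⟨n, rfl⟩
  exact ⟨n + 1, Function.iterate_succ_apply' φ n ω⟩

theorem IsMinimalSet.mapsTo {φ : C(Ω, Ω)} {m : Set Ω} (h : IsMinimalSet φ m) :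
    MapsTo φ m m :=
  h.prop.2.2

/-- (single `m` in `ō`): every orbit closure contains exactly one minimal set. -/
def SingleMinimalInOrbitClosures (φ : C(Ω, Ω)) : Prop :=
  ∀ ω : Ω, ∃! m : Set Ω, IsMinimalSet φ m ∧ m ⊆ orbitClosure φ ω

variable [MeasurableSpace Ω]

/-- UE(`ō`): for every `ω`, the subsystem `(ō(ω), φ)` is uniquely ergodic. -/
def OrbitClosuresUniquelyErgodic (φ : C(Ω, Ω)) : Prop :=
  ∀ ω : Ω, UniquelyErgodic ((mapsTo_orbitClosure φ ω).restrict φ _ _)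

/-- (supp `μ_e` = `m`): the support of every ergodic probability measure is a minimal set. -/
def ErgodicSupportsMinimal (φ : C(Ω, Ω)) : Prop :=
  ∀ μ : Measure Ω, IsProbabilityMeasure μ → Ergodic φ μ → IsMinimalSet φ μ.support

/-- (single `μ_e` on `m`): for every minimal set `m`, the subsystem `(m, φ)` is uniquely
ergodic. -/
def MinimalSubsystemsUniquelyErgodic (φ : C(Ω, Ω)) : Prop :=
  ∀ (m : Set Ω) (hm : IsMinimalSet φ m), UniquelyErgodic (hm.mapsTo.restrict φ m m)

end Dynamics

end

end Semicascade

/-!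
All convergence questions are read off the real averages
`orbitAverage φ s c x = ∑ n ∈ s, c n • (x ∘ φ ^ n)`: an operator of `co {V ^ n}` sends a functional
`l` to `x ↦ l (orbitAverage φ s c x)`, and at a point evaluation it gives the value of the average
at that point. Invariant measures of a subsystem `(S, φ)` are treated as invariant measures on `Ω`
carried by `S` (`IsInvariantOn`).

The averages at a point `p` are integrals against convex combinations of Dirac measures on the
orbit of `p`. Since the space of probability measures is compact, along any ultrafilter the averages
of an ergodic sequence tend to an invariant measure on the orbit closure
(`exists_isInvariantOn_tendsto`); this also gives the existence of invariant measures. If the orbit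
closures are uniquely ergodic, the limit does not depend on the ultrafilter, so the averages
converge pointwise. A functional on `C(Ω)` is dominated by integration against a finite measure
(`exists_measure_abs_le_integral`, through its total variation and the Riesz–Markov–Kakutani
theorem), and dominated convergence turns pointwise into weak-star convergence.

Conversely, let two invariant measures on an orbit closure integrate some `x` differently. A Cesàro
average of `x` has the same two integrals, so it takes values near both along the orbit. Cesàro
averages started at suitable times on the orbit form an ergodic sequence whose values at `x`
oscillate (`AllErgodicSequencesConverge.orbitClosuresUniquelyErgodic`). Hence convergence of ergodic
sequences alone implies unique ergodicity of orbit closures, and no larger nets are needed.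

If one ergodic sequence converges, its limit at `x`, as a function of the point, is a pointwise
limit of continuous functions and is constant along orbits. In a minimal set every orbit is dense,
so the Baire category theorem makes the limit constant there (`eq_of_tendsto_of_dense_levelSets`),
and the constant is the integral of `x` for every invariant measure on the minimal set.

The characterization of unique ergodicity of orbit closures uses two facts. The support of an
ergodic measure is an orbit closure (`exists_orbitClosure_eq_support`), which, when uniquely ergodic,
cannot contain a smaller closed invariant set. By the Krein–Milman theorem, a closed set with only
one ergodic measure has only one invariant measure (`IsInvariantOn.eq_of_forall_ergodic_eq`).
-/

set_option linter.unusedSectionVars false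

namespace Semicascade

noncomputable section

/-! ### Invariant probability measures carried by a set -/

section InvariantMeasures

/-- `μ` is a `φ`-invariant probability measure on `Ω` carried by `S`. For a closed `φ`-invariant
set `S` these measures correspond to the invariant probability measures of the subsystem
`(S, φ)`, and working with them avoids measures on subtypes. -/
structure IsInvariantOn {Ω : Type u} [MeasurableSpace Ω] (φ : Ω → Ω) (S : Set Ω)
    (μ : Measure Ω) : Prop where
  isProbabilityMeasure : IsProbabilityMeasure μ
  measurePreserving : MeasurePreserving φ μ μ
  compl_eq_zero : μ Sᶜ = 0

theorem IsInvariantOn.mono {Ω : Type u} [MeasurableSpace Ω] {φ : Ω → Ω} {S T : Set Ω}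
    {μ : Measure Ω} (h : IsInvariantOn φ S μ) (hST : S ⊆ T) : IsInvariantOn φ T μ :=
  ⟨h.1, h.2, measure_mono_null (compl_subset_compl.2 hST) h.3⟩

theorem IsInvariantOn.map_subtype_val {Ω : Type u} [MeasurableSpace Ω] {φ : Ω → Ω}
    (hφ : Measurable φ) {S : Set Ω} (hS : MeasurableSet S) (hm : MapsTo φ S S)
    {μ : Measure S} (h1 : IsProbabilityMeasure μ)
    (h2 : MeasurePreserving (hm.restrict φ S S) μ μ) :
    IsInvariantOn φ S (μ.map Subtype.val) := by
  refine ⟨Measure.isProbabilityMeasure_map measurable_subtype_coe.aemeasurable, ⟨hφ, ?_⟩, ?_⟩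
  · rw [Measure.map_map hφ measurable_subtype_coe]
    conv_rhs => rw [← h2.map_eq]
    rw [Measure.map_map measurable_subtype_coe h2.measurable]
    rfl
  · rw [Measure.map_apply measurable_subtype_coe hS.compl]
    simp

theorem uniquelyErgodic_restrict_iff {Ω : Type u} [MeasurableSpace Ω] {φ : Ω → Ω}
    (hφ : Measurable φ) {S : Set Ω} (hS : MeasurableSet S) (hm : MapsTo φ S S) :
    UniquelyErgodic (hm.restrict φ S S) ↔ ∃! μ : Measure Ω, IsInvariantOn φ S μ := by
  have hr : Measurable (hm.restrict φ S S) := (hφ.comp measurable_subtype_coe).subtype_mk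
  have he := MeasurableEmbedding.subtype_coe hS
  have hcm : ∀ μ : Measure Ω, IsInvariantOn φ S μ →
      (μ.comap ((↑) : S → Ω)).map Subtype.val = μ := by
    intro μ h
    rw [he.map_comap, Subtype.range_coe]
    exact Measure.restrict_eq_self_of_ae_mem (ae_iff.2 h.compl_eq_zero)
  have hmc : ∀ ν : Measure S, (ν.map Subtype.val).comap ((↑) : S → Ω) = ν :=
    fun ν => he.comap_map ν
  have back : ∀ μ : Measure Ω, IsInvariantOn φ S μ →
      IsProbabilityMeasure (μ.comap ((↑) : S → Ω)) ∧
        MeasurePreserving (hm.restrict φ S S) (μ.comap ((↑) : S → Ω))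
          (μ.comap ((↑) : S → Ω)) := by
    intro μ h
    refine ⟨⟨?_⟩, hr, ?_⟩
    · have := h.isProbabilityMeasure
      rw [← preimage_univ (f := ((↑) : S → Ω)),
        ← Measure.map_apply measurable_subtype_coe MeasurableSet.univ, hcm μ h, measure_univ]
    · rw [← hmc (Measure.map _ _), Measure.map_map measurable_subtype_coe hr]
      have : (Subtype.val ∘ hm.restrict φ S S) = φ ∘ Subtype.val := rfl
      rw [this, ← Measure.map_map hφ measurable_subtype_coe, hcm μ h,
        h.measurePreserving.map_eq]
  constructor
  · rintro ⟨ν, ⟨h1, h2⟩, h3⟩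
    refine ⟨ν.map Subtype.val, IsInvariantOn.map_subtype_val hφ hS hm h1 h2, fun μ hμ => ?_⟩
    rw [← hcm μ hμ, h3 _ (back μ hμ)]
  · rintro ⟨μ, hμ, h3⟩
    refine ⟨μ.comap _, back μ hμ, fun ν hν => ?_⟩
    rw [← hmc ν, h3 _ (IsInvariantOn.map_subtype_val hφ hS hm hν.1 hν.2)]

variable {Ω : Type u} [MetricSpace Ω] [CompactSpace Ω] [MeasurableSpace Ω] [BorelSpace Ω]

theorem integrable_continuousMap (μ : Measure Ω) [IsFiniteMeasure μ] (x : C(Ω, ℝ)) :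
    Integrable (fun ω => x ω) μ :=
  x.continuous.integrable_of_hasCompactSupport (HasCompactSupport.of_compactSpace _)

theorem measure_eq_of_forall_integral_eq {μ ν : Measure Ω} [IsFiniteMeasure μ]
    [IsFiniteMeasure ν] (h : ∀ x : C(Ω, ℝ), ∫ ω, x ω ∂μ = ∫ ω, x ω ∂ν) : μ = ν :=
  ext_of_forall_integral_eq_of_IsFiniteMeasure fun f => h f.toContinuousMap

theorem measurePreserving_iff_forall_integral {φ : C(Ω, Ω)} {μ : Measure Ω}
    [IsFiniteMeasure μ] :
    MeasurePreserving φ μ μ ↔ ∀ x : C(Ω, ℝ), ∫ ω, x (φ ω) ∂μ = ∫ ω, x ω ∂μ := by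
  have key : ∀ x : C(Ω, ℝ), ∫ ω, x ω ∂(μ.map φ) = ∫ ω, x (φ ω) ∂μ := fun x =>
    integral_map φ.continuous.aemeasurable x.continuous.aestronglyMeasurable
  constructor
  · intro h x
    rw [← key, h.map_eq]
  · intro h
    refine ⟨φ.continuous.measurable, measure_eq_of_forall_integral_eq fun x => ?_⟩
    rw [key, h]

/-- The distance to `S` as a continuous function: it detects whether a measure is carried by the
closed set `S`. -/
def distTo (S : Set Ω) : C(Ω, ℝ) := ⟨fun ω => Metric.infDist ω S, Metric.continuous_infDist_pt S⟩

theorem compl_eq_zero_iff_integral_distTo {S : Set Ω} (hS : IsClosed S) (hne : S.Nonempty)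
    {μ : Measure Ω} [IsFiniteMeasure μ] : μ Sᶜ = 0 ↔ ∫ ω, distTo S ω ∂μ = 0 := by
  have h0 : (0 : Ω → ℝ) ≤ fun ω => distTo S ω := fun ω => Metric.infDist_nonneg
  rw [integral_eq_zero_iff_of_nonneg h0 (integrable_continuousMap μ _), ← mem_ae_iff]
  refine eventually_congr (Eventually.of_forall fun ω => ?_)
  exact hS.mem_iff_infDist_zero hne

theorem continuous_integral_probabilityMeasure (x : C(Ω, ℝ)) :
    Continuous fun μ : ProbabilityMeasure Ω => ∫ ω, x ω ∂(μ : Measure Ω) :=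
  ProbabilityMeasure.continuous_integral_boundedContinuousFunction
    (BoundedContinuousFunction.mkOfCompact x)

theorem isClosed_setOf_isInvariantOn (φ : C(Ω, Ω)) {S : Set Ω} (hS : IsClosed S)
    (hne : S.Nonempty) :
    IsClosed {μ : ProbabilityMeasure Ω | IsInvariantOn φ S (μ : Measure Ω)} := by
  have : {μ : ProbabilityMeasure Ω | IsInvariantOn φ S (μ : Measure Ω)} =
      (⋂ x : C(Ω, ℝ), {μ : ProbabilityMeasure Ω |
        ∫ ω, (x.comp φ) ω ∂(μ : Measure Ω) = ∫ ω, x ω ∂(μ : Measure Ω)}) ∩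
      {μ : ProbabilityMeasure Ω | ∫ ω, distTo S ω ∂(μ : Measure Ω) = 0} := by
    ext μ
    simp only [mem_inter_iff, mem_iInter, mem_ofPred_eq]
    rw [← compl_eq_zero_iff_integral_distTo hS hne]
    constructor
    · intro h
      exact ⟨measurePreserving_iff_forall_integral.1 h.2, h.3⟩
    · rintro ⟨h1, h2⟩
      exact ⟨inferInstance, measurePreserving_iff_forall_integral.2 h1, h2⟩
  rw [this]
  refine (isClosed_iInter fun x => ?_).inter ?_
  · exact isClosed_eq (continuous_integral_probabilityMeasure _)
      (continuous_integral_probabilityMeasure _)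
  · exact isClosed_eq (continuous_integral_probabilityMeasure _) continuous_const

end InvariantMeasures

/-! ### Averages along orbits -/

section Averages

variable {Ω : Type u} [MetricSpace Ω] [CompactSpace Ω]

/-- The average `∑ n ∈ s, c n • (x ∘ φ ^ n)` of a real continuous function. -/
def orbitAverage (φ : C(Ω, Ω)) (s : Finset ℕ) (c : ℕ → ℝ) (x : C(Ω, ℝ)) : C(Ω, ℝ) :=
  ⟨fun ω => ∑ n ∈ s, c n * x (φ^[n] ω), continuous_finsetSum _ fun n _ =>
    continuous_const.mul (x.continuous.comp (φ.continuous.iterate n))⟩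

theorem orbitAverage_apply (φ : C(Ω, Ω)) (s : Finset ℕ) (c : ℕ → ℝ) (x : C(Ω, ℝ)) (ω : Ω) :
    orbitAverage φ s c x ω = ∑ n ∈ s, c n * x (φ^[n] ω) := rfl

theorem abs_orbitAverage_le (φ : C(Ω, Ω)) {s : Finset ℕ} {c : ℕ → ℝ} (h0 : ∀ n ∈ s, 0 ≤ c n)
    (h1 : ∑ n ∈ s, c n = 1) (x : C(Ω, ℝ)) (ω : Ω) : |orbitAverage φ s c x ω| ≤ ‖x‖ := by
  rw [orbitAverage_apply]
  calc |∑ n ∈ s, c n * x (φ^[n] ω)| ≤ ∑ n ∈ s, |c n * x (φ^[n] ω)| :=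
        Finset.abs_sum_le_sum_abs _ _
    _ ≤ ∑ n ∈ s, c n * ‖x‖ := by
        refine Finset.sum_le_sum fun n hn => ?_
        rw [abs_mul, abs_of_nonneg (h0 n hn)]
        exact mul_le_mul_of_nonneg_left (x.norm_coe_le_norm _) (h0 n hn)
    _ = ‖x‖ := by rw [← Finset.sum_mul, h1, one_mul]

variable [MeasurableSpace Ω] [BorelSpace Ω]

theorem integral_orbitAverage {φ : C(Ω, Ω)} {s : Finset ℕ} {c : ℕ → ℝ}
    (h1 : ∑ n ∈ s, c n = 1) {μ : Measure Ω} [IsFiniteMeasure μ]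
    (hμ : MeasurePreserving φ μ μ) (x : C(Ω, ℝ)) :
    ∫ ω, orbitAverage φ s c x ω ∂μ = ∫ ω, x ω ∂μ := by
  have key : ∀ n : ℕ, ∫ ω, x (φ^[n] ω) ∂μ = ∫ ω, x ω ∂μ := fun n => by
    conv_rhs => rw [← (hμ.iterate n).map_eq]
    exact (integral_map (hμ.iterate n).measurable.aemeasurable
      x.continuous.aestronglyMeasurable).symm
  have hint : ∀ n : ℕ, Integrable (fun ω => x (φ^[n] ω)) μ := fun n =>
    integrable_continuousMap μ (x.comp ⟨_, φ.continuous.iterate n⟩)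
  simp only [orbitAverage_apply]
  rw [integral_finsetSum _ fun n _ => (hint n).const_mul _]
  simp_rw [integral_const_mul, key]
  rw [← Finset.sum_mul, h1, one_mul]

/-- The averages of `x` at a point are integrals of `x` against a convex combination of Dirac
measures along the orbit. -/
theorem exists_probabilityMeasure_integral_eq_orbitAverage (φ : C(Ω, Ω)) {s : Finset ℕ}
    {c : ℕ → ℝ} (h0 : ∀ n ∈ s, 0 ≤ c n) (h1 : ∑ n ∈ s, c n = 1) (p : Ω) :
    ∃ μ : ProbabilityMeasure Ω, ∀ x : C(Ω, ℝ),
      ∫ ω, x ω ∂(μ : Measure Ω) = orbitAverage φ s c x p := by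
  refine ⟨⟨∑ n ∈ s, ENNReal.ofReal (c n) • Measure.dirac (φ^[n] p), ⟨?_⟩⟩, fun x => ?_⟩
  · simp only [Measure.coe_finsetSum, Finset.sum_apply, Measure.smul_apply, measure_univ,
      smul_eq_mul, mul_one]
    rw [← ENNReal.ofReal_sum_of_nonneg h0, h1, ENNReal.ofReal_one]
  · rw [ProbabilityMeasure.coe_mk, integral_finsetSum_measure, orbitAverage_apply]
    · refine Finset.sum_congr rfl fun n hn => ?_
      rw [integral_smul_measure, integral_dirac, ENNReal.toReal_ofReal (h0 n hn), smul_eq_mul]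
    · intro n _
      exact (integrable_continuousMap _ x).smul_measure ENNReal.ofReal_ne_top

/-- Averages that become invariant along an ultrafilter have an invariant probability measure as
limit: this is weak-star compactness of the space of probability measures. -/
theorem exists_isInvariantOn_tendsto {ι : Type*} (F : Ultrafilter ι) {φ : C(Ω, Ω)} {S : Set Ω}
    (hS : IsClosed S) (hm : MapsTo φ S S) {p : Ω} (hp : p ∈ S) {s : ι → Finset ℕ}
    {c : ι → ℕ → ℝ} (h0 : ∀ i, ∀ n ∈ s i, 0 ≤ c i n) (h1 : ∀ i, ∑ n ∈ s i, c i n = 1)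
    (hinv : ∀ x : C(Ω, ℝ), Tendsto (fun i => orbitAverage φ (s i) (c i) x p -
      orbitAverage φ (s i) (c i) (x.comp φ) p) F (𝓝 0)) :
    ∃ μ : Measure Ω, IsInvariantOn φ S μ ∧ ∀ x : C(Ω, ℝ),
      Tendsto (fun i => orbitAverage φ (s i) (c i) x p) F (𝓝 (∫ ω, x ω ∂μ)) := by
  choose P hP using fun i => exists_probabilityMeasure_integral_eq_orbitAverage φ (h0 i) (h1 i) p
  obtain ⟨μ, -, hμ⟩ := isCompact_univ.ultrafilter_le_nhds (F.map P) (by simp)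
  have hlim : ∀ x : C(Ω, ℝ), Tendsto (fun i => orbitAverage φ (s i) (c i) x p) F
      (𝓝 (∫ ω, x ω ∂(μ : Measure Ω))) := fun x => by
    simp_rw [← hP]
    exact ((continuous_integral_probabilityMeasure x).tendsto μ).comp hμ
  refine ⟨μ, ⟨inferInstance, measurePreserving_iff_forall_integral.2 fun x => ?_, ?_⟩, hlim⟩
  · have := tendsto_nhds_unique (hinv x) ((hlim x).sub (hlim (x.comp φ)))
    simp only [ContinuousMap.comp_apply] at this
    linarith
  · rw [compl_eq_zero_iff_integral_distTo hS ⟨p, hp⟩]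
    refine tendsto_nhds_unique (hlim (distTo S)) ?_
    refine tendsto_const_nhds.congr fun i => ?_
    rw [orbitAverage_apply]
    refine (Finset.sum_eq_zero fun n _ => ?_).symm
    rw [show distTo S (φ^[n] p) = 0 from Metric.infDist_zero_of_mem (hm.iterate n hp), mul_zero]

/-- The Cesàro weights `1 / (N + 1)` on `{0, …, N}`. -/
def cesaroWeight (N : ℕ) : ℕ → ℝ := fun _ => ((N : ℝ) + 1)⁻¹

theorem cesaroWeight_nonneg (N n : ℕ) : 0 ≤ cesaroWeight N n := by
  unfold cesaroWeight; positivity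

theorem sum_cesaroWeight (N : ℕ) : ∑ n ∈ Finset.range (N + 1), cesaroWeight N n = 1 := by
  simp only [cesaroWeight, Finset.sum_const, Finset.card_range, nsmul_eq_mul, Nat.cast_add,
    Nat.cast_one]
  exact mul_inv_cancel₀ (by positivity)

/-- Cesàro averages telescope: they are almost invariant, uniformly in the point. -/
theorem abs_cesaro_sub_cesaro_comp_le (φ : C(Ω, Ω)) (N : ℕ) (x : C(Ω, ℝ)) (p : Ω) :
    |orbitAverage φ (Finset.range (N + 1)) (cesaroWeight N) x p -
      orbitAverage φ (Finset.range (N + 1)) (cesaroWeight N) (x.comp φ) p| ≤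
      2 * ‖x‖ * ((N : ℝ) + 1)⁻¹ := by
  have h : orbitAverage φ (Finset.range (N + 1)) (cesaroWeight N) x p -
      orbitAverage φ (Finset.range (N + 1)) (cesaroWeight N) (x.comp φ) p =
      (x p - x (φ^[N + 1] p)) * ((N : ℝ) + 1)⁻¹ := by
    simp only [orbitAverage_apply, ContinuousMap.comp_apply, cesaroWeight]
    rw [← Finset.mul_sum, ← Finset.mul_sum, ← mul_sub, ← Finset.sum_sub_distrib, mul_comm]
    congr 1
    simp_rw [← Function.iterate_succ_apply' φ]
    exact Finset.sum_range_sub' (fun n => x (φ^[n] p)) (N + 1)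
  rw [h, abs_mul, abs_of_nonneg (by positivity : (0 : ℝ) ≤ ((N : ℝ) + 1)⁻¹)]
  refine mul_le_mul_of_nonneg_right ?_ (by positivity)
  have h1 := abs_le.1 (x.norm_coe_le_norm p)
  have h2 := abs_le.1 (x.norm_coe_le_norm (φ^[N + 1] p))
  rw [abs_le]
  constructor <;> linarith [h1.1, h1.2, h2.1, h2.2]

theorem tendsto_cesaro_bound (C : ℝ) :
    Tendsto (fun N : ℕ => C * ((N : ℝ) + 1)⁻¹) atTop (𝓝 0) := by
  have := (tendsto_one_div_add_atTop_nhds_zero_nat (𝕜 := ℝ)).const_mul C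
  simpa using this

/-- Krylov–Bogolyubov: a nonempty closed invariant set carries an invariant measure. -/
theorem exists_isInvariantOn (φ : C(Ω, Ω)) {S : Set Ω} (hS : IsClosed S) (hm : MapsTo φ S S)
    (hne : S.Nonempty) : ∃ μ : Measure Ω, IsInvariantOn φ S μ := by
  obtain ⟨p, hp⟩ := hne
  obtain ⟨μ, hμ, -⟩ := exists_isInvariantOn_tendsto (hyperfilter ℕ) hS hm hp
    (fun N n _ => cesaroWeight_nonneg N n) sum_cesaroWeight fun x => by
      refine Tendsto.mono_left ?_ (Nat.hyperfilter_le_atTop)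
      exact squeeze_zero_norm (fun N => abs_cesaro_sub_cesaro_comp_le φ N x p)
        (tendsto_cesaro_bound _)
  exact ⟨μ, hμ⟩

end Averages

/-! ### Minimal sets and orbit closures -/

section MinimalSets

variable {Ω : Type u} [TopologicalSpace Ω] {φ : C(Ω, Ω)} {S m m' : Set Ω} {ω : Ω}

theorem isClosed_orbitClosure (φ : C(Ω, Ω)) (ω : Ω) : IsClosed (orbitClosure φ ω) :=
  isClosed_closure

theorem iterate_mem_orbitClosure (φ : C(Ω, Ω)) (ω : Ω) (n : ℕ) :
    φ^[n] ω ∈ orbitClosure φ ω :=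
  subset_closure ⟨n, rfl⟩

theorem self_mem_orbitClosure (φ : C(Ω, Ω)) (ω : Ω) : ω ∈ orbitClosure φ ω :=
  iterate_mem_orbitClosure φ ω 0

theorem orbitClosure_subset (hS : IsClosed S) (hm : MapsTo φ S S) (hω : ω ∈ S) :
    orbitClosure φ ω ⊆ S := by
  refine closure_minimal ?_ hS
  rintro _ ⟨n, rfl⟩
  exact hm.iterate n hω

theorem IsMinimalSet.isClosed (h : IsMinimalSet φ m) : IsClosed m := h.prop.2.1

theorem IsMinimalSet.nonempty (h : IsMinimalSet φ m) : m.Nonempty := h.prop.1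

theorem IsMinimalSet.eq_of_subset (h : IsMinimalSet φ m) (hne : S.Nonempty) (hS : IsClosed S)
    (hm : MapsTo φ S S) (hSm : S ⊆ m) : S = m :=
  Minimal.eq_of_subset h ⟨hne, hS, hm⟩ hSm

theorem IsMinimalSet.orbitClosure_eq (h : IsMinimalSet φ m) (hω : ω ∈ m) :
    orbitClosure φ ω = m :=
  h.eq_of_subset ⟨ω, self_mem_orbitClosure φ ω⟩ (isClosed_orbitClosure φ ω)
    (mapsTo_orbitClosure φ ω) (orbitClosure_subset h.isClosed h.mapsTo hω)

theorem IsMinimalSet.eq_of_mem (h : IsMinimalSet φ m) (h' : IsMinimalSet φ m') (hω : ω ∈ m)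
    (hω' : ω ∈ m') : m = m' := by
  rw [← h.orbitClosure_eq hω, h'.orbitClosure_eq hω']

theorem exists_isMinimalSet_subset [CompactSpace Ω] (hne : S.Nonempty) (hS : IsClosed S)
    (hm : MapsTo φ S S) : ∃ m, m ⊆ S ∧ IsMinimalSet φ m := by
  refine zorn_superset_nonempty {s : Set Ω | s.Nonempty ∧ IsClosed s ∧ MapsTo φ s s} ?_ S
    ⟨hne, hS, hm⟩
  intro c hc hchain hcne
  have : Nonempty c := hcne.to_subtype
  refine ⟨⋂₀ c, ⟨?_, isClosed_sInter fun s hs => (hc hs).2.1, ?_⟩,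
    fun s hs => sInter_subset_of_mem hs⟩
  · rw [sInter_eq_iInter]
    refine IsCompact.nonempty_iInter_of_directed_nonempty_isCompact_isClosed _ ?_
      (fun t => (hc t.2).1) (fun t => (hc t.2).2.1.isCompact) fun t => (hc t.2).2.1
    intro t t'
    rcases hchain.total t.2 t'.2 with h | h
    · exact ⟨t, Subset.rfl, h⟩
    · exact ⟨t', h, Subset.rfl⟩
  · exact fun ω hω s hs => (hc hs).2.2 (hω s hs)

end MinimalSets

/-! ### Supports of ergodic measures -/

section Supports

variable {Ω : Type u} [MetricSpace Ω] [CompactSpace Ω] [MeasurableSpace Ω] [BorelSpace Ω]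
  {φ : C(Ω, Ω)} {μ : Measure Ω}

theorem mapsTo_support (hμ : MeasurePreserving φ μ μ) : MapsTo φ μ.support μ.support := by
  intro ω hω
  rw [Measure.mem_support_iff_forall] at hω ⊢
  intro V hV
  obtain ⟨O, hOV, hO, hωO⟩ := mem_nhds_iff.1 hV
  refine lt_of_lt_of_le ?_ (measure_mono hOV)
  rw [← hμ.measure_preimage hO.measurableSet.nullMeasurableSet]
  exact hω _ (φ.continuous.continuousAt.preimage_mem_nhds (hO.mem_nhds hωO))

/-- Almost every orbit of an ergodic measure is dense in the support: the points whose orbit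
visits a given set of positive measure form a backward invariant set, hence a set of full
measure. -/
theorem exists_orbitClosure_eq_support [IsProbabilityMeasure μ] (hμ : Ergodic φ μ) :
    ∃ ω, orbitClosure φ ω = μ.support := by
  have key : ∀ O ∈ TopologicalSpace.countableBasis Ω, 0 < μ O →
      ∀ᵐ ω ∂μ, ∃ n : ℕ, φ^[n] ω ∈ O := by
    intro O hO hpos
    have hOo := TopologicalSpace.isOpen_of_mem_countableBasis hO
    set E : Set Ω := {ω | ∃ n : ℕ, φ^[n] ω ∈ O} with hE
    have hEo : IsOpen E := by
      have : E = ⋃ n : ℕ, φ^[n] ⁻¹' O := by ext; simp [hE]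
      rw [this]
      exact isOpen_iUnion fun n => hOo.preimage (φ.continuous.iterate n)
    have hsub : φ ⁻¹' E ⊆ E := by
      rintro ω ⟨n, hn⟩
      exact ⟨n + 1, by rwa [Function.iterate_succ_apply]⟩
    rcases hμ.ae_empty_or_univ_of_preimage_ae_le hEo.measurableSet.nullMeasurableSet
      hsub.eventuallyLE with h | h
    · rw [ae_eq_empty] at h
      have hOE : O ⊆ E := fun ω hω => ⟨0, hω⟩
      exact absurd (measure_mono_null hOE h) hpos.ne'
    · exact eventuallyEq_univ.1 h
  have hall : ∀ᵐ ω ∂μ, ∀ O ∈ TopologicalSpace.countableBasis Ω, 0 < μ O →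
      ∃ n : ℕ, φ^[n] ω ∈ O := by
    rw [ae_ball_iff (TopologicalSpace.countable_countableBasis Ω)]
    intro O hO
    by_cases hpos : 0 < μ O
    · filter_upwards [key O hO hpos] with ω hω _ using hω
    · exact Eventually.of_forall fun ω h => absurd h hpos
  obtain ⟨ω, h1, h2⟩ := (hall.and Measure.support_mem_ae).exists
  refine ⟨ω, subset_antisymm (orbitClosure_subset Measure.isClosed_support
    (mapsTo_support hμ.toMeasurePreserving) h2) fun p hp => ?_⟩
  rw [orbitClosure, (TopologicalSpace.isBasis_countableBasis Ω).mem_closure_iff]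
  intro O hO hpO
  obtain ⟨n, hn⟩ := h1 O hO ((Measure.mem_support_iff_forall p).1 hp O
    ((TopologicalSpace.isOpen_of_mem_countableBasis hO).mem_nhds hpO))
  exact ⟨φ^[n] ω, hn, n, rfl⟩

theorem IsInvariantOn.support_subset {S : Set Ω} (hS : IsClosed S) (h : IsInvariantOn φ S μ) :
    μ.support ⊆ S :=
  Measure.support_subset_of_isClosed hS (mem_ae_iff.2 h.compl_eq_zero)

end Supports

/-! ### Invariant measures and ergodic measures -/

section ErgodicMeasures

variable {Ω : Type u} [MetricSpace Ω] [CompactSpace Ω] [MeasurableSpace Ω] [BorelSpace Ω]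
  {φ : C(Ω, Ω)} {S : Set Ω}

/-- Integration of continuous functions, as an embedding of the probability measures into the
locally convex space `C(Ω, ℝ) → ℝ` with the topology of pointwise convergence. -/
def integralFunctional (μ : ProbabilityMeasure Ω) : C(Ω, ℝ) → ℝ := fun x =>
  ∫ ω, x ω ∂(μ : Measure Ω)

theorem integral_smul_add_smul {μ ν : Measure Ω} [IsFiniteMeasure μ] [IsFiniteMeasure ν]
    {a b : ENNReal} (ha : a ≠ ⊤) (hb : b ≠ ⊤) (x : C(Ω, ℝ)) :
    ∫ ω, x ω ∂(a • μ + b • ν) = a.toReal * ∫ ω, x ω ∂μ + b.toReal * ∫ ω, x ω ∂ν := by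
  rw [integral_add_measure ((integrable_continuousMap _ x).smul_measure ha)
    ((integrable_continuousMap _ x).smul_measure hb), integral_smul_measure,
    integral_smul_measure]
  rfl

theorem convex_image_isInvariantOn (φ : C(Ω, Ω)) (S : Set Ω) :
    Convex ℝ (integralFunctional '' {μ : ProbabilityMeasure Ω |
      IsInvariantOn φ S (μ : Measure Ω)}) := by
  rintro _ ⟨μ, hμ, rfl⟩ _ ⟨ν, hν, rfl⟩ a b ha hb hab
  have hprob : IsProbabilityMeasure (ENNReal.ofReal a • (μ : Measure Ω) +
      ENNReal.ofReal b • (ν : Measure Ω)) := by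
    constructor
    simp only [Measure.add_apply, Measure.smul_apply, measure_univ, smul_eq_mul, mul_one]
    rw [← ENNReal.ofReal_add ha hb, hab, ENNReal.ofReal_one]
  refine ⟨⟨_, hprob⟩, ⟨hprob, ?_, ?_⟩, ?_⟩
  · exact (hμ.measurePreserving.smul_measure _).add_measure
      (hν.measurePreserving.smul_measure _)
  · simp [hμ.compl_eq_zero, hν.compl_eq_zero]
  · funext x
    simp only [integralFunctional, ProbabilityMeasure.coe_mk]
    rw [integral_smul_add_smul ENNReal.ofReal_ne_top ENNReal.ofReal_ne_top,
      ENNReal.toReal_ofReal ha, ENNReal.toReal_ofReal hb]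
    rfl

theorem ergodic_of_integralFunctional_mem_extremePoints {μ : ProbabilityMeasure Ω}
    (hμ : IsInvariantOn φ S (μ : Measure Ω))
    (hext : integralFunctional μ ∈ (integralFunctional '' {μ : ProbabilityMeasure Ω |
      IsInvariantOn φ S (μ : Measure Ω)}).extremePoints ℝ) : Ergodic φ (μ : Measure Ω) := by
  refine Ergodic.of_mem_extremePoints ⟨⟨hμ.measurePreserving, inferInstance⟩, ?_⟩
  rintro ν₁ ⟨hν₁, hp₁⟩ ν₂ ⟨hν₂, hp₂⟩ ⟨a, b, ha, hb, hab, h⟩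
  have haT : a ≠ ⊤ := fun h => by simp [h] at hab
  have hbT : b ≠ ⊤ := fun h => by simp [h] at hab
  -- the components of a measure carried by `S` are carried by `S`
  have hz := hμ.compl_eq_zero
  rw [← h] at hz
  simp only [Measure.add_apply, Measure.smul_apply, smul_eq_mul, add_eq_zero, mul_eq_zero,
    ha.ne', hb.ne', false_or] at hz
  have heq := hext.2 (mem_image_of_mem integralFunctional
    (show IsInvariantOn φ S ((⟨ν₁, hp₁⟩ : ProbabilityMeasure Ω) : Measure Ω) from
      ⟨hp₁, hν₁, hz.1⟩)) (mem_image_of_mem integralFunctional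
    (show IsInvariantOn φ S ((⟨ν₂, hp₂⟩ : ProbabilityMeasure Ω) : Measure Ω) from
      ⟨hp₂, hν₂, hz.2⟩))
    ⟨a.toReal, b.toReal, ENNReal.toReal_pos ha.ne' haT, ENNReal.toReal_pos hb.ne' hbT, by
      rw [← ENNReal.toReal_add haT hbT, hab, ENNReal.toReal_one], by
      funext x
      simp only [integralFunctional, ← h]
      rw [integral_smul_add_smul haT hbT]
      rfl⟩
  exact measure_eq_of_forall_integral_eq fun x => congrFun heq x

/-- If all ergodic measures on `S` coincide, then all invariant measures on `S` coincide, by the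
Krein–Milman theorem. -/
theorem IsInvariantOn.eq_of_forall_ergodic_eq (hS : IsClosed S) (hne : S.Nonempty)
    (h : ∀ μ ν : Measure Ω, IsInvariantOn φ S μ → Ergodic φ μ → IsInvariantOn φ S ν →
      Ergodic φ ν → μ = ν) {μ ν : Measure Ω} (hμ : IsInvariantOn φ S μ)
    (hν : IsInvariantOn φ S ν) : μ = ν := by
  set K := integralFunctional '' {μ : ProbabilityMeasure Ω | IsInvariantOn φ S (μ : Measure Ω)}
    with hK
  have hcomp : IsCompact K := (isClosed_setOf_isInvariantOn φ hS hne).isCompact.image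
    (continuous_pi fun x => continuous_integral_probabilityMeasure x)
  have hsub : (K.extremePoints ℝ).Subsingleton := by
    intro e he e' he'
    obtain ⟨μ, hμ, rfl⟩ := he.1
    obtain ⟨ν, hν, rfl⟩ := he'.1
    have := h μ ν hμ (ergodic_of_integralFunctional_mem_extremePoints hμ he) hν
      (ergodic_of_integralFunctional_mem_extremePoints hν he')
    rw [Subtype.ext this]
  have hKsub : K.Subsingleton := by
    rw [← closure_convexHull_extremePoints hcomp (convex_image_isInvariantOn φ S)]
    rcases hsub.eq_empty_or_singleton with h | ⟨e, h⟩ <;> rw [h] <;> simp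
  have hp := hμ.isProbabilityMeasure
  have hp' := hν.isProbabilityMeasure
  have heq := hKsub (mem_image_of_mem integralFunctional
    (show IsInvariantOn φ S ((⟨μ, hp⟩ : ProbabilityMeasure Ω) : Measure Ω) from hμ))
    (mem_image_of_mem integralFunctional
    (show IsInvariantOn φ S ((⟨ν, hp'⟩ : ProbabilityMeasure Ω) : Measure Ω) from hν))
  exact measure_eq_of_forall_integral_eq fun x => congrFun heq x

end ErgodicMeasures

/-! ### Unique ergodicity of orbit closures -/

section OrbitClosures

variable {Ω : Type u} [MetricSpace Ω] [CompactSpace Ω] [MeasurableSpace Ω] [BorelSpace Ω]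
  {φ : C(Ω, Ω)}

theorem orbitClosuresUniquelyErgodic_iff : OrbitClosuresUniquelyErgodic φ ↔
    ∀ ω, ∃! μ : Measure Ω, IsInvariantOn φ (orbitClosure φ ω) μ :=
  forall_congr' fun ω => uniquelyErgodic_restrict_iff φ.continuous.measurable
    (isClosed_orbitClosure φ ω).measurableSet _

theorem minimalSubsystemsUniquelyErgodic_iff : MinimalSubsystemsUniquelyErgodic φ ↔
    ∀ m, IsMinimalSet φ m → ∃! μ : Measure Ω, IsInvariantOn φ m μ :=
  forall₂_congr fun _ hm => uniquelyErgodic_restrict_iff φ.continuous.measurable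
    hm.isClosed.measurableSet _

theorem OrbitClosuresUniquelyErgodic.singleMinimalInOrbitClosures
    (h : OrbitClosuresUniquelyErgodic φ) : SingleMinimalInOrbitClosures φ := by
  rw [orbitClosuresUniquelyErgodic_iff] at h
  intro ω
  obtain ⟨m, hmω, hm⟩ := exists_isMinimalSet_subset ⟨ω, self_mem_orbitClosure φ ω⟩
    (isClosed_orbitClosure φ ω) (mapsTo_orbitClosure φ ω)
  refine ⟨m, ⟨hm, hmω⟩, fun m' ⟨hm', hmω'⟩ => ?_⟩
  obtain ⟨μ, hμ⟩ := exists_isInvariantOn φ hm.isClosed hm.mapsTo hm.nonempty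
  obtain ⟨ν, hν⟩ := exists_isInvariantOn φ hm'.isClosed hm'.mapsTo hm'.nonempty
  have heq : μ = ν := (h ω).unique (hμ.mono hmω) (hν.mono hmω')
  subst heq
  have := hμ.isProbabilityMeasure
  have h1 : ∀ᵐ p ∂μ, p ∈ m := mem_ae_iff.2 hμ.compl_eq_zero
  have h2 : ∀ᵐ p ∂μ, p ∈ m' := mem_ae_iff.2 hν.compl_eq_zero
  obtain ⟨p, hp, hp'⟩ := (h1.and h2).exists
  exact hm'.eq_of_mem hm hp' hp

theorem OrbitClosuresUniquelyErgodic.ergodicSupportsMinimal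
    (h : OrbitClosuresUniquelyErgodic φ) : ErgodicSupportsMinimal φ := by
  rw [orbitClosuresUniquelyErgodic_iff] at h
  intro μ _ hμ
  obtain ⟨ω, hω⟩ := exists_orbitClosure_eq_support hμ
  obtain ⟨m, hmω, hm⟩ := exists_isMinimalSet_subset ⟨ω, self_mem_orbitClosure φ ω⟩
    (isClosed_orbitClosure φ ω) (mapsTo_orbitClosure φ ω)
  obtain ⟨ν, hν⟩ := exists_isInvariantOn φ hm.isClosed hm.mapsTo hm.nonempty
  have hμω : IsInvariantOn φ (orbitClosure φ ω) μ :=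
    ⟨inferInstance, hμ.toMeasurePreserving, by rw [hω]; exact Measure.measure_compl_support⟩
  have heq : μ = ν := (h ω).unique hμω (hν.mono hmω)
  subst heq
  rwa [subset_antisymm (hν.support_subset hm.isClosed) (hω ▸ hmω)]

theorem OrbitClosuresUniquelyErgodic.minimalSubsystemsUniquelyErgodic
    (h : OrbitClosuresUniquelyErgodic φ) : MinimalSubsystemsUniquelyErgodic φ := by
  rw [orbitClosuresUniquelyErgodic_iff] at h
  rw [minimalSubsystemsUniquelyErgodic_iff]
  intro m hm
  obtain ⟨ω, hω⟩ := hm.nonempty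
  simpa only [hm.orbitClosure_eq hω] using h ω

theorem orbitClosuresUniquelyErgodic_of_minimal (h1 : SingleMinimalInOrbitClosures φ)
    (h2 : ErgodicSupportsMinimal φ) (h3 : MinimalSubsystemsUniquelyErgodic φ) :
    OrbitClosuresUniquelyErgodic φ := by
  rw [minimalSubsystemsUniquelyErgodic_iff] at h3
  rw [orbitClosuresUniquelyErgodic_iff]
  intro ω
  have hcl := isClosed_orbitClosure φ ω
  have hne : (orbitClosure φ ω).Nonempty := ⟨ω, self_mem_orbitClosure φ ω⟩
  obtain ⟨m, -, hmu⟩ := h1 ω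
  have key : ∀ μ : Measure Ω, IsInvariantOn φ (orbitClosure φ ω) μ → Ergodic φ μ →
      IsMinimalSet φ m ∧ IsInvariantOn φ m μ := by
    intro μ hμ hμe
    have hsm := h2 μ hμ.isProbabilityMeasure hμe
    rw [← hmu _ ⟨hsm, hμ.support_subset hcl⟩]
    exact ⟨hsm, hμ.1, hμ.2, Measure.measure_compl_support⟩
  obtain ⟨μ, hμ⟩ := exists_isInvariantOn φ hcl (mapsTo_orbitClosure φ ω) hne
  refine ⟨μ, hμ, fun ν hν => IsInvariantOn.eq_of_forall_ergodic_eq hcl hne ?_ hν hμ⟩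
  intro μ₁ μ₂ hμ₁ he₁ hμ₂ he₂
  exact (h3 m (key μ₁ hμ₁ he₁).1).unique (key μ₁ hμ₁ he₁).2 (key μ₂ hμ₂ he₂).2

end OrbitClosures

/-! ### Total variation of a functional and weak Cauchy sequences -/

section TotalVariation

open scoped CompactlySupported NNReal

variable {Ω : Type u} [TopologicalSpace Ω] [CompactSpace Ω]

/-- The values of `l` on the order interval `{g | |g| ≤ f}`. -/
def variationSet (l : StrongDual ℝ C(Ω, ℝ)) (f : C_c(Ω, ℝ≥0)) : Set ℝ :=
  l '' {g | ∀ ω, |g ω| ≤ f ω}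

theorem zero_mem_variationSet (l : StrongDual ℝ C(Ω, ℝ)) (f : C_c(Ω, ℝ≥0)) :
    0 ∈ variationSet l f :=
  ⟨0, fun ω => by simp, map_zero l⟩

theorem bddAbove_variationSet (l : StrongDual ℝ C(Ω, ℝ)) (f : C_c(Ω, ℝ≥0)) :
    BddAbove (variationSet l f) := by
  refine ⟨‖l‖ * ‖(f.toReal : C(Ω, ℝ))‖, ?_⟩
  rintro _ ⟨g, hg, rfl⟩
  refine (le_abs_self _).trans ((l.le_opNorm g).trans ?_)
  refine mul_le_mul_of_nonneg_left ?_ (norm_nonneg l)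
  rw [ContinuousMap.norm_le _ (norm_nonneg _)]
  intro ω
  refine (hg ω).trans ?_
  have := (f.toReal : C(Ω, ℝ)).norm_coe_le_norm ω
  refine le_trans (le_abs_self _) ?_
  simpa using this

/-- The total variation `|l| f = sup {l g : |g| ≤ f}` of a functional at `f ≥ 0`. -/
def variation (l : StrongDual ℝ C(Ω, ℝ)) (f : C_c(Ω, ℝ≥0)) : ℝ := sSup (variationSet l f)

theorem variation_nonneg (l : StrongDual ℝ C(Ω, ℝ)) (f : C_c(Ω, ℝ≥0)) : 0 ≤ variation l f :=
  le_csSup (bddAbove_variationSet l f) (zero_mem_variationSet l f)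

theorem le_variation (l : StrongDual ℝ C(Ω, ℝ)) {f : C_c(Ω, ℝ≥0)} {g : C(Ω, ℝ)}
    (hg : ∀ ω, |g ω| ≤ f ω) : l g ≤ variation l f :=
  le_csSup (bddAbove_variationSet l f) ⟨g, hg, rfl⟩

theorem variation_le (l : StrongDual ℝ C(Ω, ℝ)) {f : C_c(Ω, ℝ≥0)} {a : ℝ}
    (h : ∀ g : C(Ω, ℝ), (∀ ω, |g ω| ≤ f ω) → l g ≤ a) : variation l f ≤ a := by
  refine csSup_le ⟨0, zero_mem_variationSet l f⟩ ?_
  rintro _ ⟨g, hg, rfl⟩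
  exact h g hg

/-- Additivity rests on the Riesz decomposition: `|g| ≤ f₁ + f₂` splits as `g = g₁ + g₂` with
`|gᵢ| ≤ fᵢ`. -/
theorem variation_add (l : StrongDual ℝ C(Ω, ℝ)) (f₁ f₂ : C_c(Ω, ℝ≥0)) :
    variation l (f₁ + f₂) = variation l f₁ + variation l f₂ := by
  apply le_antisymm
  · refine variation_le l fun g hg => ?_
    -- truncate `g` to the interval `[-f₁, f₁]`
    let g₁ : C(Ω, ℝ) := ⟨fun ω => max (-(f₁ ω : ℝ)) (min (g ω) (f₁ ω)), by fun_prop⟩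
    have h₁ : ∀ ω, |g₁ ω| ≤ f₁ ω := fun ω => by
      have : (0 : ℝ) ≤ f₁ ω := NNReal.coe_nonneg _
      rw [abs_le]
      exact ⟨le_max_left _ _, max_le (by linarith) (min_le_right _ _)⟩
    have h₂ : ∀ ω, |(g - g₁) ω| ≤ f₂ ω := fun ω => by
      have h := abs_le.1 (hg ω)
      have e1 : (0 : ℝ) ≤ f₁ ω := NNReal.coe_nonneg _
      have e2 : (0 : ℝ) ≤ f₂ ω := NNReal.coe_nonneg _
      simp only [CompactlySupportedContinuousMap.add_apply, NNReal.coe_add] at h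
      change |g ω - max (-(f₁ ω : ℝ)) (min (g ω) (f₁ ω))| ≤ f₂ ω
      rw [abs_le]
      rcases le_total (g ω) (f₁ ω) with h3 | h3
      · rw [min_eq_left h3]
        rcases le_total (-(f₁ ω : ℝ)) (g ω) with h4 | h4
        · rw [max_eq_right h4]; constructor <;> linarith
        · rw [max_eq_left h4]; constructor <;> linarith [h.1]
      · rw [min_eq_right h3, max_eq_right (by linarith)]
        constructor <;> linarith [h.2]
    calc l g = l g₁ + l (g - g₁) := by rw [← map_add, add_sub_cancel]
      _ ≤ _ := add_le_add (le_variation l h₁) (le_variation l h₂)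
  · rw [← le_sub_iff_add_le]
    refine variation_le l fun g₁ h₁ => ?_
    rw [le_sub_comm]
    refine variation_le l fun g₂ h₂ => ?_
    rw [le_sub_iff_add_le', ← map_add]
    refine le_variation l fun ω => ?_
    simp only [CompactlySupportedContinuousMap.add_apply, NNReal.coe_add,
      ContinuousMap.add_apply]
    exact (abs_add_le _ _).trans (add_le_add (h₁ ω) (h₂ ω))

theorem mul_variation_le (l : StrongDual ℝ C(Ω, ℝ)) {c : ℝ≥0} (hc : c ≠ 0)
    (f : C_c(Ω, ℝ≥0)) : c * variation l f ≤ variation l (c • f) := by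
  have hc' : (0 : ℝ) < c := by positivity
  rw [← le_div_iff₀' hc']
  refine variation_le l fun g hg => ?_
  rw [le_div_iff₀' hc', ← smul_eq_mul, ← map_smul]
  refine le_variation l fun ω => ?_
  simp only [ContinuousMap.smul_apply, smul_eq_mul, CompactlySupportedContinuousMap.smul_apply,
    NNReal.coe_mul, abs_mul, abs_of_pos hc']
  exact mul_le_mul_of_nonneg_left (hg ω) hc'.le

theorem variation_smul (l : StrongDual ℝ C(Ω, ℝ)) (c : ℝ≥0) (f : C_c(Ω, ℝ≥0)) :
    variation l (c • f) = c * variation l f := by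
  rcases eq_or_ne c 0 with rfl | hc
  · have h := variation_add l 0 0
    rw [add_zero] at h
    simp only [zero_smul, NNReal.coe_zero, zero_mul]
    linarith
  · refine le_antisymm ?_ (mul_variation_le l hc f)
    have h := mul_variation_le l (inv_ne_zero hc) (c • f)
    rw [inv_smul_smul₀ hc, NNReal.coe_inv] at h
    rwa [inv_mul_le_iff₀ (by positivity)] at h

/-- The total variation as a positive functional. -/
def variationLinear (l : StrongDual ℝ C(Ω, ℝ)) : C_c(Ω, ℝ≥0) →ₗ[ℝ≥0] ℝ≥0 where
  toFun f := ⟨variation l f, variation_nonneg l f⟩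
  map_add' f g := NNReal.eq (variation_add l f g)
  map_smul' c f := NNReal.eq (variation_smul l c f)

/-- Every functional on `C(Ω)` is dominated by integration against a finite measure, namely the
one representing its total variation. -/
theorem exists_measure_abs_le_integral [T2Space Ω] [MeasurableSpace Ω] [BorelSpace Ω]
    (l : StrongDual ℝ C(Ω, ℝ)) :
    ∃ μ : Measure Ω, IsFiniteMeasure μ ∧ ∀ g : C(Ω, ℝ), |l g| ≤ ∫ ω, |g ω| ∂μ := by
  have hreg : IsFiniteMeasureOnCompacts (NNRealRMK.rieszMeasure (variationLinear l)) := by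
    unfold NNRealRMK.rieszMeasure
    infer_instance
  refine ⟨NNRealRMK.rieszMeasure (variationLinear l), ⟨isCompact_univ.measure_lt_top⟩,
    fun g => ?_⟩
  let f : C_c(Ω, ℝ≥0) :=
    ⟨⟨fun ω => ‖g ω‖₊, by fun_prop⟩, HasCompactSupport.of_compactSpace _⟩
  have hf : ∀ ω, (f ω : ℝ) = |g ω| := fun ω => rfl
  have h := NNRealRMK.integral_rieszMeasure (variationLinear l) f
  simp only [hf] at h
  rw [h]
  change |l g| ≤ variation l f
  rw [abs_le']
  refine ⟨le_variation l fun ω => (hf ω).ge, ?_⟩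
  rw [← map_neg]
  exact le_variation l fun ω => by simp [hf]

/-- A uniformly bounded, pointwise convergent sequence in `C(Ω)` is weakly Cauchy, by dominated
convergence for the total variation of the functional. -/
theorem exists_tendsto_of_bounded_of_pointwise {Ω : Type u} [MetricSpace Ω] [CompactSpace Ω]
    [MeasurableSpace Ω] [BorelSpace Ω]
    (l : StrongDual ℝ C(Ω, ℝ)) {f : ℕ → C(Ω, ℝ)} {C : ℝ} (hC : ∀ n ω, |f n ω| ≤ C)
    {F : Ω → ℝ} (hF : ∀ ω, Tendsto (fun n => f n ω) atTop (𝓝 (F ω))) :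
    ∃ a : ℝ, Tendsto (fun n => l (f n)) atTop (𝓝 a) := by
  obtain ⟨μ, hμ, hl⟩ := exists_measure_abs_le_integral l
  have hFm : AEStronglyMeasurable F μ := aestronglyMeasurable_of_tendsto_ae atTop
    (fun n => (f n).continuous.aestronglyMeasurable) (Eventually.of_forall hF)
  have hFC : ∀ ω, |F ω| ≤ C := fun ω =>
    le_of_tendsto (hF ω).abs (Eventually.of_forall fun n => hC n ω)
  have hFi : Integrable F μ := Integrable.of_bound hFm C (Eventually.of_forall hFC)
  have hint : ∀ n, Integrable (fun ω => |f n ω - F ω|) μ := fun n =>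
    ((integrable_continuousMap μ (f n)).sub hFi).abs
  have hlim : Tendsto (fun n => ∫ ω, |f n ω - F ω| ∂μ) atTop (𝓝 0) := by
    have := tendsto_integral_of_dominated_convergence (μ := μ)
      (F := fun n ω => |f n ω - F ω|) (f := fun _ => (0 : ℝ)) (fun _ => 2 * C)
      (fun n => (hint n).aestronglyMeasurable) (integrable_const _)
      (fun n => Eventually.of_forall fun ω => by
        rw [Real.norm_eq_abs, abs_abs]
        exact (abs_sub _ _).trans (by linarith [hC n ω, hFC ω]))
      (Eventually.of_forall fun ω => by simpa using ((hF ω).sub_const (F ω)).abs)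
    simpa using this
  refine cauchySeq_tendsto_of_complete (Metric.cauchySeq_iff'.2 fun ε hε => ?_)
  obtain ⟨N, hN⟩ := eventually_atTop.1 (hlim.eventually_lt_const (half_pos hε))
  refine ⟨N, fun n hn => ?_⟩
  rw [Real.dist_eq, ← map_sub]
  calc |l (f n - f N)| ≤ ∫ ω, |(f n - f N) ω| ∂μ := hl _
    _ ≤ ∫ ω, (|f n ω - F ω| + |f N ω - F ω|) ∂μ := by
        refine integral_mono (integrable_continuousMap μ (f n - f N)).abs
          ((hint n).add (hint N)) fun ω => ?_
        change |f n ω - f N ω| ≤ |f n ω - F ω| + |f N ω - F ω|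
        rw [abs_sub_comm (f N ω)]
        exact abs_sub_le _ _ _
    _ = ∫ ω, |f n ω - F ω| ∂μ + ∫ ω, |f N ω - F ω| ∂μ := integral_add (hint n) (hint N)
    _ < ε := by linarith [hN n hn, hN N le_rfl]

end TotalVariation

/-! ### Convex combinations of powers of the adjoint Koopman operator -/

section KoopmanAverages

variable {𝕜 : Type v} [RCLike 𝕜] {Ω : Type u}

theorem adjointOp_pow_apply {X : Type u} [NormedAddCommGroup X] [NormedSpace 𝕜 X]
    (U : X →L[𝕜] X) (n : ℕ) (l : StrongDual 𝕜 X) (x : X) :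
    ((adjointOp U ^ n) l) x = l ((U ^ n) x) := by
  induction n generalizing l with
  | zero => rfl
  | succ n ih =>
    rw [pow_succ, mul_apply_eq_comp, ih, pow_succ']
    rfl

variable [MetricSpace Ω] [CompactSpace Ω]

theorem koopman_pow_apply (φ : C(Ω, Ω)) (n : ℕ) (x : C(Ω, 𝕜)) (ω : Ω) :
    ((koopman 𝕜 φ ^ n) x) ω = x (φ^[n] ω) := by
  induction n generalizing x with
  | zero => rfl
  | succ n ih =>
    rw [pow_succ, mul_apply_eq_comp, ih, Function.iterate_succ_apply']
    rfl

theorem norm_koopman_pow_apply_le (φ : C(Ω, Ω)) (n : ℕ) (x : C(Ω, 𝕜)) :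
    ‖(koopman 𝕜 φ ^ n) x‖ ≤ ‖x‖ := by
  rw [ContinuousMap.norm_le _ (norm_nonneg _)]
  intro ω
  rw [koopman_pow_apply]
  exact x.norm_coe_le_norm _

theorem sum_smul_adjointOp_pow_apply (φ : C(Ω, Ω)) (s : Finset ℕ) (c : ℕ → ℝ)
    (l : StrongDual 𝕜 C(Ω, 𝕜)) (x : C(Ω, 𝕜)) :
    ((∑ n ∈ s, (c n : 𝕜) • adjointOp (koopman 𝕜 φ) ^ n) l) x =
      ∑ n ∈ s, (c n : 𝕜) * l ((koopman 𝕜 φ ^ n) x) := by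
  simp only [sum_apply, smul_apply, adjointOp_pow_apply, smul_eq_mul]

theorem norm_apply_le_of_mem_coPowers {φ : C(Ω, Ω)}
    {T : StrongDual 𝕜 C(Ω, 𝕜) →L[𝕜] StrongDual 𝕜 C(Ω, 𝕜)}
    (hT : T ∈ coPowers (adjointOp (koopman 𝕜 φ))) (l : StrongDual 𝕜 C(Ω, 𝕜)) (x : C(Ω, 𝕜)) :
    ‖T l x‖ ≤ ‖l‖ * ‖x‖ := by
  obtain ⟨s, c, h0, h1, rfl⟩ := hT
  rw [sum_smul_adjointOp_pow_apply]
  calc ‖∑ n ∈ s, (c n : 𝕜) * l ((koopman 𝕜 φ ^ n) x)‖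
      ≤ ∑ n ∈ s, c n * (‖l‖ * ‖x‖) := by
        refine norm_sum_le_of_le _ fun n hn => ?_
        rw [norm_mul, RCLike.norm_ofReal, abs_of_nonneg (h0 n hn)]
        refine mul_le_mul_of_nonneg_left ((l.le_opNorm _).trans ?_) (h0 n hn)
        exact mul_le_mul_of_nonneg_left (norm_koopman_pow_apply_le φ n x) (norm_nonneg l)
    _ = ‖l‖ * ‖x‖ := by rw [← Finset.sum_mul, h1, one_mul]

variable (𝕜) in
/-- The inclusion of the real continuous functions into the scalar ones. -/
def ofRealMap : C(Ω, ℝ) →L[ℝ] C(Ω, 𝕜) :=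
  (RCLike.ofRealCLM (K := 𝕜)).compLeftContinuous ℝ Ω

theorem ofRealMap_apply (x : C(Ω, ℝ)) (ω : Ω) : ofRealMap 𝕜 x ω = (x ω : 𝕜) := rfl

theorem eq_ofRealMap_re_add_im (x : C(Ω, 𝕜)) :
    x = ofRealMap 𝕜 ⟨fun ω => RCLike.re (x ω), RCLike.continuous_re.comp x.continuous⟩ +
      (RCLike.I : 𝕜) •
        ofRealMap 𝕜 ⟨fun ω => RCLike.im (x ω), RCLike.continuous_im.comp x.continuous⟩ := by
  ext ω
  simp only [ContinuousMap.add_apply, ContinuousMap.smul_apply, ofRealMap_apply,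
    ContinuousMap.coe_mk, smul_eq_mul]
  rw [mul_comm, RCLike.re_add_im]

theorem sum_smul_adjointOp_pow_ofRealMap (φ : C(Ω, Ω)) (s : Finset ℕ) (c : ℕ → ℝ)
    (l : StrongDual 𝕜 C(Ω, 𝕜)) (x : C(Ω, ℝ)) :
    ((∑ n ∈ s, (c n : 𝕜) • adjointOp (koopman 𝕜 φ) ^ n) l) (ofRealMap 𝕜 x) =
      l (ofRealMap 𝕜 (orbitAverage φ s c x)) := by
  have h : ofRealMap 𝕜 (orbitAverage φ s c x) =
      ∑ n ∈ s, (c n : 𝕜) • (koopman 𝕜 φ ^ n) (ofRealMap 𝕜 x) := by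
    ext ω
    simp only [ofRealMap_apply, orbitAverage_apply, ContinuousMap.sum_apply,
      ContinuousMap.smul_apply, koopman_pow_apply, smul_eq_mul, map_sum, map_mul]
  rw [h, map_sum, sum_smul_adjointOp_pow_apply]
  simp only [map_smul, smul_eq_mul]

/-- The point evaluations, as elements of `X*`. -/
def evalDual (p : Ω) : StrongDual 𝕜 C(Ω, 𝕜) := ContinuousMap.evalCLM 𝕜 p

theorem evalDual_ofRealMap (p : Ω) (x : C(Ω, ℝ)) :
    evalDual (𝕜 := 𝕜) p (ofRealMap 𝕜 x) = (x p : 𝕜) := rfl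

/-- An ergodic sequence is given by averages along orbits that become invariant pointwise. -/
theorem IsErgodicNet.exists_weights {φ : C(Ω, Ω)}
    {W : ℕ → StrongDual 𝕜 C(Ω, 𝕜) →L[𝕜] StrongDual 𝕜 C(Ω, 𝕜)}
    (hW : IsErgodicNet (koopman 𝕜 φ) W) :
    ∃ (s : ℕ → Finset ℕ) (c : ℕ → ℕ → ℝ), (∀ i, ∀ n ∈ s i, 0 ≤ c i n) ∧
      (∀ i, ∑ n ∈ s i, c i n = 1) ∧
      (∀ i l x, W i l (ofRealMap 𝕜 x) = l (ofRealMap 𝕜 (orbitAverage φ (s i) (c i) x))) ∧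
      ∀ x p, Tendsto (fun i => orbitAverage φ (s i) (c i) x p -
        orbitAverage φ (s i) (c i) (x.comp φ) p) atTop (𝓝 0) := by
  choose s c h0 h1 hWsc using hW.mem_coPowers
  have hreal : ∀ i l x, W i l (ofRealMap 𝕜 x) =
      l (ofRealMap 𝕜 (orbitAverage φ (s i) (c i) x)) := fun i l x => by
    rw [hWsc i, sum_smul_adjointOp_pow_ofRealMap]
  refine ⟨s, c, h0, h1, hreal, fun x p => ?_⟩
  have h := hW.tendsto_zero (ofRealMap 𝕜 x) (evalDual p)
  have hre := (RCLike.continuous_re (K := 𝕜)).continuousAt.tendsto.comp h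
  rw [map_zero] at hre
  refine hre.congr fun i => ?_
  have hadj : (adjointOp (koopman 𝕜 φ) (W i (evalDual p))) (ofRealMap 𝕜 x) =
      W i (evalDual p) (ofRealMap 𝕜 (x.comp φ)) := rfl
  change RCLike.re (W i (evalDual p) (ofRealMap 𝕜 x) -
    (adjointOp (koopman 𝕜 φ) (W i (evalDual p))) (ofRealMap 𝕜 x)) = _
  rw [hadj, hreal, hreal, evalDual_ofRealMap, evalDual_ofRealMap, map_sub, RCLike.ofReal_re,
    RCLike.ofReal_re]

/-- Cesàro averages starting at an arbitrary time `k N` form an ergodic sequence. -/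
theorem isErgodicNet_cesaro_shift (φ : C(Ω, Ω)) (k : ℕ → ℕ) :
    IsErgodicNet (koopman 𝕜 φ) fun N : ℕ => ∑ n ∈ Finset.Ico (k N) (k N + (N + 1)),
      (cesaroWeight N n : 𝕜) • adjointOp (koopman 𝕜 φ) ^ n := by
  refine ⟨fun N => ⟨_, cesaroWeight N, fun n _ => cesaroWeight_nonneg N n, ?_, rfl⟩,
    fun x l => ?_⟩
  · rw [Finset.sum_Ico_eq_sum_range, Nat.add_sub_cancel_left]
    exact sum_cesaroWeight N
  · refine squeeze_zero_norm (fun N => ?_) (tendsto_cesaro_bound (2 * (‖l‖ * ‖x‖)))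
    set T := ∑ n ∈ Finset.Ico (k N) (k N + (N + 1)),
      (cesaroWeight N n : 𝕜) • adjointOp (koopman 𝕜 φ) ^ n with hT
    have hb : ∀ n, ‖l ((koopman 𝕜 φ ^ n) x)‖ ≤ ‖l‖ * ‖x‖ := fun n =>
      (l.le_opNorm _).trans
        (mul_le_mul_of_nonneg_left (norm_koopman_pow_apply_le φ n x) (norm_nonneg l))
    have h : (((1 - adjointOp (koopman 𝕜 φ)) * T) l) x = (((N : ℝ) + 1)⁻¹ : ℝ) *
        (l ((koopman 𝕜 φ ^ k N) x) - l ((koopman 𝕜 φ ^ (k N + (N + 1))) x)) := by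
      change (T l) x - (T l) (koopman 𝕜 φ x) = _
      rw [hT, sum_smul_adjointOp_pow_apply, sum_smul_adjointOp_pow_apply]
      simp_rw [← mul_apply_eq_comp, ← pow_succ]
      rw [← Finset.sum_sub_distrib, Finset.sum_Ico_eq_sum_range, Nat.add_sub_cancel_left]
      simp only [cesaroWeight]
      simp_rw [← mul_sub]
      rw [← Finset.mul_sum]
      congr 1
      exact Finset.sum_range_sub' (fun n => l ((koopman 𝕜 φ ^ (k N + n)) x)) (N + 1)
    rw [h, norm_mul, RCLike.norm_ofReal, abs_of_nonneg (by positivity), mul_comm]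
    refine mul_le_mul_of_nonneg_right ?_ (by positivity)
    refine (norm_sub_le _ _).trans ?_
    linarith [hb (k N), hb (k N + (N + 1))]

theorem cesaro_shift_evalDual (φ : C(Ω, Ω)) (N k : ℕ) (x : C(Ω, ℝ)) (p : Ω) :
    ((∑ n ∈ Finset.Ico k (k + (N + 1)),
      (cesaroWeight N n : 𝕜) • adjointOp (koopman 𝕜 φ) ^ n) (evalDual p)) (ofRealMap 𝕜 x) =
      (orbitAverage φ (Finset.range (N + 1)) (cesaroWeight N) x (φ^[k] p) : 𝕜) := by
  rw [sum_smul_adjointOp_pow_ofRealMap, evalDual_ofRealMap, orbitAverage_apply,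
    orbitAverage_apply, Finset.sum_Ico_eq_sum_range, Nat.add_sub_cancel_left]
  simp only [cesaroWeight, ← Function.iterate_add_apply, add_comm]

/-- Pointwise convergence of operators in `co {V ^ n}` already gives convergence in the weak-star
operator topology: these operators are uniformly bounded, so the limit is bounded. -/
theorem convergesWStarO_of_forall_exists {φ : C(Ω, Ω)}
    {W : ℕ → StrongDual 𝕜 C(Ω, 𝕜) →L[𝕜] StrongDual 𝕜 C(Ω, 𝕜)}
    (hW : ∀ i, W i ∈ coPowers (adjointOp (koopman 𝕜 φ)))
    (h : ∀ (x : C(Ω, 𝕜)) (l : StrongDual 𝕜 C(Ω, 𝕜)),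
      ∃ a : 𝕜, Tendsto (fun i => W i l x) atTop (𝓝 a)) : ConvergesWStarO W := by
  choose q hq using h
  let B : StrongDual 𝕜 C(Ω, 𝕜) →ₗ[𝕜] C(Ω, 𝕜) →ₗ[𝕜] 𝕜 := LinearMap.mk₂ 𝕜 (fun l x => q x l)
    (fun l l' x => tendsto_nhds_unique (hq x (l + l'))
      (((hq x l).add (hq x l')).congr fun i => by simp))
    (fun a l x => tendsto_nhds_unique (hq x (a • l))
      (((hq x l).const_mul a).congr fun i => by simp))
    (fun l x x' => tendsto_nhds_unique (hq (x + x') l)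
      (((hq x l).add (hq x' l)).congr fun i => by simp))
    (fun a l x => tendsto_nhds_unique (hq (a • x) l)
      (((hq x l).const_mul a).congr fun i => by simp))
  refine ⟨B.mkContinuous₂ 1 fun l x => ?_, fun x l => hq x l⟩
  rw [one_mul]
  exact le_of_tendsto (hq x l).norm
    (Eventually.of_forall fun i => norm_apply_le_of_mem_coPowers (hW i) l x)

/-- Weak Cauchy sequences of real functions remain so for scalar functionals. -/
theorem exists_tendsto_ofRealMap [MeasurableSpace Ω] [BorelSpace Ω]
    (l : StrongDual 𝕜 C(Ω, 𝕜)) {f : ℕ → C(Ω, ℝ)} {C : ℝ}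
    (hC : ∀ n ω, |f n ω| ≤ C) {F : Ω → ℝ}
    (hF : ∀ ω, Tendsto (fun n => f n ω) atTop (𝓝 (F ω))) :
    ∃ a : 𝕜, Tendsto (fun n => l (ofRealMap 𝕜 (f n))) atTop (𝓝 a) := by
  let r : C(Ω, ℝ) →L[ℝ] 𝕜 := (l.restrictScalars ℝ).comp (ofRealMap 𝕜)
  obtain ⟨a, ha⟩ := exists_tendsto_of_bounded_of_pointwise (RCLike.reCLM.comp r) hC hF
  obtain ⟨b, hb⟩ := exists_tendsto_of_bounded_of_pointwise (RCLike.imCLM.comp r) hC hF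
  refine ⟨(a : 𝕜) + b * RCLike.I, ?_⟩
  have ha' := (RCLike.continuous_ofReal (K := 𝕜)).continuousAt.tendsto.comp ha
  have hb' := (RCLike.continuous_ofReal (K := 𝕜)).continuousAt.tendsto.comp hb
  exact (ha'.add (hb'.mul_const _)).congr fun n => RCLike.re_add_im (r (f n))

end KoopmanAverages

/-! ### Unique ergodicity of orbit closures and ergodic sequences -/

section ErgodicSequences

variable {𝕜 : Type v} [RCLike 𝕜] {Ω : Type u} [MetricSpace Ω] [CompactSpace Ω]
  {φ : C(Ω, Ω)}

theorem AllErgodicNetsConverge.allErgodicSequencesConverge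
    (h : AllErgodicNetsConverge.{u, v, w} 𝕜 φ) : AllErgodicSequencesConverge 𝕜 φ := by
  intro W hW
  have hdown : Tendsto (ULift.down : ULift.{w} ℕ → ℕ) atTop atTop :=
    tendsto_atTop.2 fun n => eventually_atTop.2 ⟨⟨n⟩, fun m hm => hm⟩
  have hup : Tendsto (ULift.up : ℕ → ULift.{w} ℕ) atTop atTop :=
    tendsto_atTop.2 fun n => eventually_atTop.2 ⟨n.down, fun m hm => hm⟩
  have : IsDirectedOrder (ULift.{w} ℕ) :=
    ⟨fun a b => ⟨⟨max a.down b.down⟩, le_max_left a.down b.down, le_max_right a.down b.down⟩⟩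
  obtain ⟨Q, hQ⟩ := h (ULift.{w} ℕ) (fun i => W i.down)
    ⟨fun i => hW.mem_coPowers i.down, fun x l => (hW.tendsto_zero x l).comp hdown⟩
  exact ⟨Q, fun x l => (hQ x l).comp hup⟩

variable [MeasurableSpace Ω] [BorelSpace Ω]

theorem OrbitClosuresUniquelyErgodic.allErgodicSequencesConverge
    (h : OrbitClosuresUniquelyErgodic φ) : AllErgodicSequencesConverge 𝕜 φ := by
  rw [orbitClosuresUniquelyErgodic_iff] at h
  intro W hW
  obtain ⟨s, c, h0, h1, hreal, hinv⟩ := hW.exists_weights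
  choose ν hν hνu using h
  -- the invariant limit measures on an orbit closure are all equal
  have hpt : ∀ (x : C(Ω, ℝ)) p, Tendsto (fun i => orbitAverage φ (s i) (c i) x p) atTop
      (𝓝 (∫ ω, x ω ∂(ν p))) := by
    intro x p
    rw [tendsto_iff_ultrafilter]
    intro F hF
    obtain ⟨μ, hμ, hlim⟩ := exists_isInvariantOn_tendsto F (isClosed_orbitClosure φ p)
      (mapsTo_orbitClosure φ p) (self_mem_orbitClosure φ p) h0 h1
      fun x => (hinv x p).mono_left hF
    rw [← hνu p μ hμ]
    exact hlim x
  have hlimR : ∀ (x : C(Ω, ℝ)) (l : StrongDual 𝕜 C(Ω, 𝕜)),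
      ∃ a : 𝕜, Tendsto (fun i => W i l (ofRealMap 𝕜 x)) atTop (𝓝 a) := by
    intro x l
    simp_rw [hreal]
    exact exists_tendsto_ofRealMap l
      (fun i p => abs_orbitAverage_le φ (h0 i) (h1 i) x p) (hpt x)
  refine convergesWStarO_of_forall_exists hW.mem_coPowers fun x l => ?_
  rw [eq_ofRealMap_re_add_im x]
  simp only [map_add, map_smul]
  obtain ⟨a, ha⟩ := hlimR ⟨fun ω => RCLike.re (x ω), RCLike.continuous_re.comp x.continuous⟩ l
  obtain ⟨b, hb⟩ := hlimR ⟨fun ω => RCLike.im (x ω), RCLike.continuous_im.comp x.continuous⟩ l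
  exact ⟨_, ha.add (hb.const_smul (RCLike.I : 𝕜))⟩

theorem IsInvariantOn.exists_iterate_lt {p : Ω} {μ : Measure Ω}
    (hμ : IsInvariantOn φ (orbitClosure φ p) μ) {y : C(Ω, ℝ)} {a : ℝ}
    (h : ∫ ω, y ω ∂μ < a) : ∃ k : ℕ, y (φ^[k] p) < a := by
  have := hμ.isProbabilityMeasure
  by_contra! hcon
  have hsub : orbitClosure φ p ⊆ {ω | a ≤ y ω} := by
    refine closure_minimal ?_ (isClosed_le continuous_const y.continuous)
    rintro _ ⟨n, rfl⟩
    exact hcon n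
  have hae : ∀ᵐ ω ∂μ, a ≤ y ω := mem_of_superset (mem_ae_iff.2 hμ.compl_eq_zero) hsub
  have := integral_mono_ae (integrable_const a) (integrable_continuousMap μ y) hae
  simp only [integral_const, probReal_univ, one_smul] at this
  linarith

/-- If two invariant measures on an orbit closure give different integrals, Cesàro averages
started at suitable times along the orbit follow alternately one and the other. -/
theorem AllErgodicSequencesConverge.orbitClosuresUniquelyErgodic
    (h : AllErgodicSequencesConverge 𝕜 φ) : OrbitClosuresUniquelyErgodic φ := by
  rw [orbitClosuresUniquelyErgodic_iff]
  intro p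
  have key : ∀ μ ν : Measure Ω, IsInvariantOn φ (orbitClosure φ p) μ →
      IsInvariantOn φ (orbitClosure φ p) ν → ∀ x : C(Ω, ℝ),
      ¬ ∫ ω, x ω ∂μ < ∫ ω, x ω ∂ν := by
    intro μ ν hμ hν x hlt
    have hpμ := hμ.isProbabilityMeasure
    have hpν := hν.isProbabilityMeasure
    obtain ⟨a, haμ, haν⟩ := exists_between hlt
    obtain ⟨b, hab, hbν⟩ := exists_between haν
    set A : ℕ → C(Ω, ℝ) := fun N =>
      orbitAverage φ (Finset.range (N + 1)) (cesaroWeight N) x with hA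
    have hlow : ∀ N, ∃ k : ℕ, A N (φ^[k] p) < a := fun N => hμ.exists_iterate_lt (by
      rwa [hA, integral_orbitAverage (sum_cesaroWeight N) hμ.measurePreserving])
    have hhigh : ∀ N, ∃ k : ℕ, b < A N (φ^[k] p) := fun N => by
      obtain ⟨k, hk⟩ := hν.exists_iterate_lt (y := -A N) (a := -b) (by
        simp only [ContinuousMap.neg_apply]
        rw [integral_neg, neg_lt_neg_iff, hA,
          integral_orbitAverage (sum_cesaroWeight N) hν.measurePreserving]
        exact hbν)
      exact ⟨k, neg_lt_neg_iff.1 hk⟩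
    choose j hj using hlow
    choose k hk using hhigh
    obtain ⟨Q, hQ⟩ := h _ (isErgodicNet_cesaro_shift (𝕜 := 𝕜) φ
      fun N => if Even N then j N else k N)
    have hlim := (RCLike.continuous_re (K := 𝕜)).continuousAt.tendsto.comp
      (hQ (ofRealMap 𝕜 x) (evalDual p))
    simp only [Function.comp_def, cesaro_shift_evalDual, RCLike.ofReal_re] at hlim
    have h1 : RCLike.re (Q (evalDual p) (ofRealMap 𝕜 x)) ≤ a :=
      le_of_tendsto_of_frequently hlim (Nat.frequently_even.mono fun N hN => by
        rw [if_pos hN]; exact (hj N).le)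
    have h2 : b ≤ RCLike.re (Q (evalDual p) (ofRealMap 𝕜 x)) :=
      ge_of_tendsto_of_frequently hlim (Nat.frequently_odd.mono fun N hN => by
        rw [if_neg (Nat.not_even_iff_odd.2 hN)]; exact (hk N).le)
    linarith
  obtain ⟨μ, hμ⟩ := exists_isInvariantOn φ (isClosed_orbitClosure φ p)
    (mapsTo_orbitClosure φ p) ⟨p, self_mem_orbitClosure φ p⟩
  refine ⟨μ, hμ, fun ν hν => ?_⟩
  have := hμ.isProbabilityMeasure
  have := hν.isProbabilityMeasure
  exact measure_eq_of_forall_integral_eq fun x =>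
    le_antisymm (not_lt.1 (key μ ν hμ hν x)) (not_lt.1 (key ν μ hν hμ x))

end ErgodicSequences

/-! ### Convergence of one ergodic sequence and minimal sets -/

section MinimalSubsystems

/-- A pointwise limit of continuous functions on a Baire space all of whose level sets are empty
or dense is constant: it is almost constant on some nonempty open set. -/
theorem eq_of_tendsto_of_dense_levelSets {Y : Type*} [TopologicalSpace Y] [BaireSpace Y]
    {f : ℕ → Y → ℝ} (hf : ∀ n, Continuous (f n)) {F : Y → ℝ}
    (hF : ∀ y, Tendsto (fun n => f n y) atTop (𝓝 (F y)))
    (hd : ∀ y, Dense {z | F z = F y}) (y₁ y₂ : Y) : F y₁ = F y₂ := by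
  have : Nonempty Y := ⟨y₁⟩
  refine eq_of_abs_sub_nonpos (le_of_forall_pos_le_add fun δ hδ => ?_)
  obtain ⟨ε, hε, hδε⟩ : ∃ ε > 0, δ = 3 * ε := ⟨δ / 3, by positivity, by ring⟩
  obtain ⟨N, hN⟩ := nonempty_interior_of_iUnion_of_closed
    (f := fun N => {y | ∀ n ≥ N, |f n y - f N y| ≤ ε})
    (fun N => by
      simp only [ofPred_forall]
      exact isClosed_iInter fun n => isClosed_iInter fun _ =>
        isClosed_le ((hf n).sub (hf N)).abs continuous_const)
    (by
      refine eq_univ_of_forall fun y => mem_iUnion.2 ?_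
      obtain ⟨N, hN⟩ := Metric.cauchySeq_iff'.1 (hF y).cauchySeq ε hε
      exact ⟨N, fun n hn => (hN n hn).le⟩)
  set O := interior {y | ∀ n ≥ N, |f n y - f N y| ≤ ε} with hO
  have hOF : ∀ y ∈ O, |F y - f N y| ≤ ε := fun y hy =>
    le_of_tendsto ((hF y).sub_const _).abs
      (eventually_atTop.2 ⟨N, fun n hn => interior_subset hy n hn⟩)
  obtain ⟨p, hpO, hp⟩ := (hd y₁).inter_open_nonempty O isOpen_interior hN
  obtain ⟨q, ⟨hqO, hqp⟩, hq⟩ := (hd y₂).inter_open_nonempty (O ∩ {z | |f N z - f N p| < ε})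
    (isOpen_interior.inter (isOpen_lt ((hf N).sub continuous_const).abs continuous_const))
    ⟨p, hpO, by simpa using hε⟩
  have e1 := abs_le.1 (hOF p hpO)
  have e2 := abs_le.1 (hOF q hqO)
  have e3 := abs_lt.1 (show |f N q - f N p| < ε from hqp)
  rw [← show F p = F y₁ from hp, ← show F q = F y₂ from hq, abs_le]
  constructor <;> linarith [e1.1, e1.2, e2.1, e2.2, e3.1, e3.2]

variable {𝕜 : Type v} [RCLike 𝕜] {Ω : Type u} [MetricSpace Ω] [CompactSpace Ω]
  {φ : C(Ω, Ω)} [MeasurableSpace Ω] [BorelSpace Ω]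

theorem SomeErgodicSequenceConverges.minimalSubsystemsUniquelyErgodic
    (h : SomeErgodicSequenceConverges 𝕜 φ) : MinimalSubsystemsUniquelyErgodic φ := by
  rw [minimalSubsystemsUniquelyErgodic_iff]
  obtain ⟨W, hW, Q, hQ⟩ := h
  obtain ⟨s, c, h0, h1, hreal, hinv⟩ := hW.exists_weights
  set F : C(Ω, ℝ) → Ω → ℝ := fun x p => RCLike.re (Q (evalDual p) (ofRealMap 𝕜 x)) with hFdef
  have hF : ∀ x p, Tendsto (fun i => orbitAverage φ (s i) (c i) x p) atTop (𝓝 (F x p)) := by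
    intro x p
    have := (RCLike.continuous_re (K := 𝕜)).continuousAt.tendsto.comp
      (hQ (ofRealMap 𝕜 x) (evalDual p))
    simpa only [Function.comp_def, hreal, evalDual_ofRealMap, RCLike.ofReal_re] using this
  have hFφ : ∀ x p, F x (φ p) = F x p := by
    intro x p
    refine tendsto_nhds_unique (hF x (φ p)) ?_
    have h := (hF x p).sub (hinv x p)
    rw [sub_zero] at h
    refine h.congr fun i => ?_
    rw [sub_sub_cancel]
    simp only [orbitAverage_apply, ContinuousMap.comp_apply, ← Function.iterate_succ_apply,
      ← Function.iterate_succ_apply']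
  have hFiter : ∀ x p (n : ℕ), F x (φ^[n] p) = F x p := by
    intro x p n
    induction n with
    | zero => rfl
    | succ n ih => rw [Function.iterate_succ_apply', hFφ, ih]
  intro m hm
  have : CompactSpace m := isCompact_iff_compactSpace.1 hm.isClosed.isCompact
  -- every orbit in `m` is dense in `m`, and the limit is constant along orbits
  have hdense : ∀ (x : C(Ω, ℝ)) (y : m), Dense {z : m | F x z = F x y} := by
    intro x y z
    rw [mem_closure_iff]
    rintro _ ⟨O, hO, rfl⟩ hzO
    have hz : (z : Ω) ∈ orbitClosure φ y := by rw [hm.orbitClosure_eq y.2]; exact z.2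
    obtain ⟨_, hn, n, rfl⟩ := mem_closure_iff.1 hz O hO hzO
    exact ⟨⟨φ^[n] y, hm.mapsTo.iterate n y.2⟩, hn, hFiter x y n⟩
  have hconst : ∀ x, ∀ p ∈ m, ∀ q ∈ m, F x p = F x q := fun x p hp q hq =>
    eq_of_tendsto_of_dense_levelSets (Y := m)
      (f := fun i z => orbitAverage φ (s i) (c i) x z)
      (fun i => (orbitAverage φ (s i) (c i) x).continuous.comp continuous_subtype_val)
      (fun z => hF x z) (hdense x) ⟨p, hp⟩ ⟨q, hq⟩
  obtain ⟨p, hp⟩ := hm.nonempty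
  have hint : ∀ μ : Measure Ω, IsInvariantOn φ m μ → ∀ x : C(Ω, ℝ), ∫ ω, x ω ∂μ = F x p := by
    intro μ hμ x
    have := hμ.isProbabilityMeasure
    have hae : ∀ᵐ ω ∂μ, ω ∈ m := mem_ae_iff.2 hμ.compl_eq_zero
    have hlim := tendsto_integral_of_dominated_convergence (μ := μ)
      (F := fun i ω => orbitAverage φ (s i) (c i) x ω) (f := fun _ => F x p) (fun _ => ‖x‖)
      (fun i => (orbitAverage φ (s i) (c i) x).continuous.aestronglyMeasurable)
      (integrable_const _)
      (fun i => Eventually.of_forall fun ω => abs_orbitAverage_le φ (h0 i) (h1 i) x ω)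
      (by
        filter_upwards [hae] with ω hω
        rw [← hconst x ω hω p hp]
        exact hF x ω)
    simp only [integral_orbitAverage (h1 _) hμ.measurePreserving, integral_const,
      probReal_univ, one_smul] at hlim
    exact tendsto_nhds_unique tendsto_const_nhds hlim
  obtain ⟨μ, hμ⟩ := exists_isInvariantOn φ hm.isClosed hm.mapsTo hm.nonempty
  refine ⟨μ, hμ, fun ν hν => ?_⟩
  have := hμ.isProbabilityMeasure
  have := hν.isProbabilityMeasure
  exact measure_eq_of_forall_integral_eq fun x => by rw [hint μ hμ, hint ν hν]

end MinimalSubsystems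

end

end Semicascade

theorem lemma3p2 (𝕜 : Type v) [RCLike 𝕜] {Ω : Type u} [MetricSpace Ω] [CompactSpace Ω]
    [MeasurableSpace Ω] [BorelSpace Ω] (φ : C(Ω, Ω)) :
    ((Semicascade.AllErgodicNetsConverge.{u, v, w} 𝕜 φ →
        Semicascade.OrbitClosuresUniquelyErgodic φ) ∧
      (Semicascade.OrbitClosuresUniquelyErgodic φ →
        Semicascade.AllErgodicSequencesConverge 𝕜 φ)) ∧
    (Semicascade.SomeErgodicSequenceConverges 𝕜 φ →
      Semicascade.MinimalSubsystemsUniquelyErgodic φ) ∧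
    (Semicascade.OrbitClosuresUniquelyErgodic φ ↔
      Semicascade.SingleMinimalInOrbitClosures φ ∧
      Semicascade.ErgodicSupportsMinimal φ ∧
      Semicascade.MinimalSubsystemsUniquelyErgodic φ) :=
  ⟨⟨fun h => h.allErgodicSequencesConverge.orbitClosuresUniquelyErgodic,
      fun h => h.allErgodicSequencesConverge⟩,
    fun h => h.minimalSubsystemsUniquelyErgodic,
    fun h => ⟨h.singleMinimalInOrbitClosures, h.ergodicSupportsMinimal,
      h.minimalSubsystemsUniquelyErgodic⟩,
    fun h => Semicascade.orbitClosuresUniquelyErgodic_of_minimal h.1 h.2.1 h.2.2⟩
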